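/- For integers $p\ge 2$, $1\le d\le p$ and real $\lambda>0$, let $\mathcal G_{p,d}(\lambda)$ be the set of real symmetric positive definite $p\times p$ matrices $\Theta$ such that the graph $G(\Theta)=([p],E)$ with $\{i,j\}\in E\iff i\neq j,\ \Theta_{ij}\ne 0$ has maximum degree at most $d$, and $|\Theta_{ij}|/\Theta_{ii}\ge\lambda$ for all $i,j$ with $\{i,j\}\in E$ (in both orientations). The (stationary) Glauber dynamics of $\Theta$ starts from $\mathbf X^{(0)}\sim\mathcal N(0,\Theta^{-1})$; in round $k\ge 1$ a vertex $I^{(k)}=i$ is drawn uniformly from $[p]$, independently of the past, coordinate $i$ is redrawn as $$X_i^{(k)}\sim\mathcal N\Big(-\sum_{j\ne i}\tfrac{\Theta_{ij}}{\Theta_{ii}}X_j^{(k-1)},\ \tfrac1{\Theta_{ii}}\Big),$$ and the other coordinates are kept. In continuous time there are $p$ updates per unit of time on average, and an observation time $T$ is identified with the deterministic number $n=Tp$ of updates, the data being $\mathcal D_n=(\mathbf X^{(k)},I^{(k)})_{k=1}^n$. Write $\mathbb P_\Theta$ for the law of $\mathcal D_n$. An estimator is a measurable map $\widehat G$ from data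 to graphs on $[p]$. **Theorem.** Let $\beta_{\max}<1$. There is a constant $K>0$, depending only on $\beta_{\max}$, such that the following holds for all integers $p\ge 2$, $1\le d\le p$, all $0<\lambda\le\beta_{\max}$, all $\delta\in(0,1/2)$ and all $T$ with $n=Tp\in\{0,1,2,\dots\}$. If some estimator $\widehat G$ satisfies $$\sup_{\Theta\in\mathcal G_{p,d}(\lambda)}\mathbb P_\Theta\big[\widehat G(\mathcal D_n)\ne G(\Theta)\big]\le\frac12,$$ then $$T\ \ge\ \frac{\log\left(\frac{pd}{4}\right)\,\delta\,\left[\frac{2(1-\delta)-1}{2(1-\delta)}\right]}{K\,\lambda^2\,\log p}.$$ Equivalently, if $T$ is smaller than the right-hand side, every estimator has maximum probability of error greater than $1/2$. (In particular, taking $\beta_{\max}=1/2$, a single universal $K$ serves all $d\ge2$ and $\lambda$ with $d\lambda<1$.) -/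

import Mathlib

open MeasureTheory ProbabilityTheory
open scoped ENNReal

noncomputable section

namespace GlauberGGM

/-- The state space `ℝ^p`. -/
abbrev State (p : ℕ) : Type := EuclideanSpace ℝ (Fin p)

/-- The graph on the vertices `Fin p` that records the sparsity pattern of a symmetric matrix `Θ`:
distinct vertices `i`, `j` are joined exactly when `Θ i j` (equivalently `Θ j i`) is nonzero. -/
def supportGraph {p : ℕ} (Θ : Matrix (Fin p) (Fin p) ℝ) : SimpleGraph (Fin p) :=
  SimpleGraph.fromRel fun i j => Θ i j ≠ 0

/-- The class `𝒢_{p,d}(lam)`: positive definite (precision) matrices whose sparsity graph has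
maximum degree at most `d`, and whose partial regression coefficients satisfy
`|Θ i j| / Θ i i ≥ lam` along all edges (in both orientations). -/
def precisionClass (p d : ℕ) (lam : ℝ) : Set (Matrix (Fin p) (Fin p) ℝ) :=
  {Θ | Θ.PosDef ∧
    (∀ i, ((supportGraph Θ).neighborSet i).ncard ≤ d) ∧
    (∀ i j, (supportGraph Θ).Adj i j → lam ≤ |Θ i j| / Θ i i)}

/-- The conditional mean of coordinate `i` given the others under `N(0, Θ⁻¹)`:
`∑_{j ≠ i} β_{ij} x_j` with `β_{ij} = - Θ i j / Θ i i`. -/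
def condMean {p : ℕ} (Θ : Matrix (Fin p) (Fin p) ℝ) (i : Fin p) (x : State p) : ℝ :=
  ∑ j ∈ Finset.univ.erase i, -(Θ i j / Θ i i) * x j

/-- Replace coordinate `i` of `x` by `y`. -/
def setCoord {p : ℕ} (x : State p) (i : Fin p) (y : ℝ) : State p :=
  WithLp.toLp 2 (Function.update (fun j => x j) i y)

lemma measurable_condMean {p : ℕ} (Θ : Matrix (Fin p) (Fin p) ℝ) (i : Fin p) :
    Measurable (condMean Θ i) := by
  unfold condMean
  fun_prop

lemma measurable_setCoord {p : ℕ} (i : Fin p) :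
    Measurable fun q : State p × ℝ => setCoord q.1 i q.2 := by
  unfold setCoord
  refine (WithLp.measurable_toLp 2 _).comp (measurable_pi_lambda _ fun j => ?_)
  by_cases h : j = i
  · subst h
    simpa using measurable_snd
  · simp only [Function.update_of_ne h]
    fun_prop

/-- Resampling of one coordinate: given the state `x` and the vertex `i`, coordinate `i` is
replaced by a draw from its conditional law `N(condMean, 1 / Θ i i)` given the other
coordinates; the other coordinates are kept. -/
def siteKernel {p : ℕ} (Θ : Matrix (Fin p) (Fin p) ℝ) : Kernel (State p × Fin p) (State p) where
  toFun q := (gaussianReal (condMean Θ q.2 q.1) (1 / Θ q.2 q.2).toNNReal).map (setCoord q.1 q.2)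
  measurable' := by
    refine measurable_from_prod_countable_left fun i => ?_
    have hm : Measurable fun q : State p × ℝ => setCoord q.1 i (condMean Θ i q.1 + q.2) :=
      (measurable_setCoord i).comp
        (measurable_fst.prodMk (((measurable_condMean Θ i).comp measurable_fst).add measurable_snd))
    have key := ((Kernel.id ×ₖ Kernel.const (State p)
      (gaussianReal 0 (1 / Θ i i).toNNReal)).map
        fun q : State p × ℝ => setCoord q.1 i (condMean Θ i q.1 + q.2)).measurable
    convert key using 1
    funext x
    have hs : Measurable (setCoord x i) := (measurable_setCoord i).comp measurable_prodMk_left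
    rw [Kernel.map_apply _ hm, Kernel.prod_apply, Kernel.id_apply, Kernel.const_apply,
      Measure.dirac_prod, Measure.map_map hm measurable_prodMk_left]
    have h0 : gaussianReal (condMean Θ i x) (1 / Θ i i).toNNReal
        = (gaussianReal 0 (1 / Θ i i).toNNReal).map (condMean Θ i x + ·) := by
      rw [gaussianReal_map_const_add, zero_add]
    simp only [h0]
    rw [Measure.map_map hs (measurable_const_add _)]
    rfl

instance {p : ℕ} (Θ : Matrix (Fin p) (Fin p) ℝ) : IsMarkovKernel (siteKernel Θ) where
  isProbabilityMeasure q :=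
    Measure.isProbabilityMeasure_map
      ((measurable_setCoord q.2).comp measurable_prodMk_left).aemeasurable

/-- One round of the Glauber dynamics from the state `x`: a vertex `i` is drawn uniformly at
random and coordinate `i` is resampled. The output is the pair (updated vertex, new state). -/
def glauberKernel {p : ℕ} (Θ : Matrix (Fin p) (Fin p) ℝ) : Kernel (State p) (Fin p × State p) :=
  Kernel.const (State p) (uniformOn (Set.univ : Set (Fin p))) ⊗ₖ siteKernel Θ

/-- The data of `n` rounds: entry `k` is the pair of the vertex updated in that round and
the state after the update. -/
abbrev Data (p n : ℕ) : Type := Fin n → Fin p × State p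

/-- Joint law of the data of the first `n` rounds and of the current state, for the stationary
Glauber dynamics of `N(0, Θ⁻¹)`. -/
def glauberJoint {p : ℕ} (Θ : Matrix (Fin p) (Fin p) ℝ) : (n : ℕ) → Measure (Data p n × State p)
  | 0 => (multivariateGaussian 0 Θ⁻¹).map fun x => (Fin.elim0, x)
  | n + 1 =>
      (glauberJoint Θ n ⊗ₘ (glauberKernel Θ).comap Prod.snd measurable_snd).map
        fun q : (Data p n × State p) × (Fin p × State p) =>
          (Fin.snoc (α := fun _ => Fin p × State p) q.1.1 q.2, q.2.2)

/-- Law of the data `(I⁽¹⁾, X⁽¹⁾), …, (I⁽ⁿ⁾, X⁽ⁿ⁾)` under the model `Θ`. -/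
def dataLaw {p : ℕ} (Θ : Matrix (Fin p) (Fin p) ℝ) (n : ℕ) : Measure (Data p n) :=
  (glauberJoint Θ n).map Prod.fst

/-- Maximum probability of error of a graph estimator over `𝒢_{p,d}(lam)`. -/
def maxError (p d : ℕ) (lam : ℝ) (n : ℕ) (Ψ : Data p n → SimpleGraph (Fin p)) : ℝ≥0∞ :=
  ⨆ Θ ∈ precisionClass p d lam, dataLaw Θ n {D | Ψ D ≠ supportGraph Θ}

end GlauberGGM

end

/-! The logarithms in the claim cancel: d ≤ p gives log(pd/4) ≤ 2 log p, and the factors in δ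
contribute at most 1/4. It therefore suffices to bound T λ² below by a constant depending only on
βmax.

Single-edge graphs already force this. If log(pd/4) > 0 then p ≥ 3, and the p edges of a cycle are
distinct. Each gives a model with one correlated pair of correlation λ, to be compared with the
independent model Θ = 1. A round carries information only if it updates an endpoint of the edge,
which has probability 2/p, and such an update costs relative entropy of order λ². With the initial
state included, the total is at most λ²/(2(1-λ²)) · (1 + 2T) (`entropyLE_dataLaw`). Entropy is used
in its dual form throughout, so the chain rule (`EntropyLE.compProd`) and passage to images need no
densities on the data space.

The events "the estimator returns edge i" are disjoint, so under the independent model one of them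
has probability at most 1/p, while under its own model it has probability at least 1/2. Testing the
dual inequality on s times its indicator gives the Fano-type bound `mul_half_le_of_maxError_le`.

The cost of the initial state does not shrink with T, hence two regimes in `le_time_mul_sq`. For
small λ a fixed s suffices. For λ bounded below, at least one round is needed, so T ≥ 1/p; a small T
λ² then forces p to be large, which allows a large s. -/

noncomputable section

namespace GlauberGGM

/-- The relative entropy of `P` with respect to `Q` is at most `K`, in the dual form of
Donsker and Varadhan. -/
def EntropyLE {α : Type*} [MeasurableSpace α] (P Q : Measure α) (K : ℝ) : Prop :=
  ∀ f : α → ℝ, Measurable f → (∃ C, ∀ x, |f x| ≤ C) →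
    ∫ x, f x ∂P ≤ K + Real.log (∫ x, Real.exp (f x) ∂Q)

/-! ### Relative entropy in dual form: chain rule, change of measure, Gaussian case -/

section Entropy

variable {α β : Type*} [MeasurableSpace α] [MeasurableSpace β]

lemma integrable_of_abs_le {P : Measure α} [IsFiniteMeasure P] {f : α → ℝ} (hf : Measurable f)
    {C : ℝ} (hC : ∀ x, |f x| ≤ C) : Integrable f P :=
  Integrable.of_bound hf.aestronglyMeasurable C (ae_of_all _ hC)

lemma integrable_exp_of_abs_le {P : Measure α} [IsFiniteMeasure P] {f : α → ℝ} (hf : Measurable f)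
    {C : ℝ} (hC : ∀ x, |f x| ≤ C) : Integrable (fun x => Real.exp (f x)) P :=
  integrable_of_abs_le (C := Real.exp C) hf.exp fun x => by
    rw [abs_of_pos (Real.exp_pos _)]
    exact Real.exp_le_exp.2 ((le_abs_self _).trans (hC x))

lemma exp_neg_le_integral_exp {P : Measure α} [IsProbabilityMeasure P] {f : α → ℝ}
    (hf : Measurable f) {C : ℝ} (hC : ∀ x, |f x| ≤ C) :
    Real.exp (-C) ≤ ∫ x, Real.exp (f x) ∂P := by
  have := integral_mono (μ := P) (integrable_const (Real.exp (-C)))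
    (integrable_exp_of_abs_le hf hC) fun x => Real.exp_le_exp.2 (neg_le_of_abs_le (hC x))
  simpa using this

lemma integral_exp_le_exp {P : Measure α} [IsProbabilityMeasure P] {f : α → ℝ}
    (hf : Measurable f) {C : ℝ} (hC : ∀ x, |f x| ≤ C) :
    ∫ x, Real.exp (f x) ∂P ≤ Real.exp C := by
  have := integral_mono (μ := P) (integrable_exp_of_abs_le hf hC)
    (integrable_const (Real.exp C)) fun x => Real.exp_le_exp.2 (le_of_abs_le (hC x))
  simpa using this

lemma integral_le_log_integral_exp {P : Measure α} [IsProbabilityMeasure P] {f : α → ℝ}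
    (hf : Integrable f P) (hfe : Integrable (fun x => Real.exp (f x)) P) :
    ∫ x, f x ∂P ≤ Real.log (∫ x, Real.exp (f x) ∂P) := by
  have h := convexOn_exp.map_integral_le (μ := P) Real.continuous_exp.continuousOn isClosed_univ
    (by simp) hf hfe
  exact (Real.le_log_iff_exp_le ((Real.exp_pos _).trans_le h)).2 h

lemma EntropyLE.refl (P : Measure α) [IsProbabilityMeasure P] : EntropyLE P P 0 := by
  rintro f hf ⟨C, hC⟩
  rw [zero_add]
  exact integral_le_log_integral_exp (integrable_of_abs_le hf hC) (integrable_exp_of_abs_le hf hC)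

lemma EntropyLE.mono {P Q : Measure α} {K L : ℝ} (h : EntropyLE P Q K) (hKL : K ≤ L) :
    EntropyLE P Q L :=
  fun f hf hC => (h f hf hC).trans (by gcongr)

lemma EntropyLE.map {P Q : Measure α} {K : ℝ} (h : EntropyLE P Q K) {g : α → β}
    (hg : Measurable g) : EntropyLE (P.map g) (Q.map g) K := by
  rintro f hf ⟨C, hC⟩
  rw [integral_map hg.aemeasurable hf.aestronglyMeasurable,
    integral_map hg.aemeasurable hf.exp.aestronglyMeasurable]
  exact h (fun x => f (g x)) (hf.comp hg) ⟨C, fun x => hC _⟩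

/-- Chain rule. The kernel bound applied to f(x, ·) leaves the function g(x) = log ∫ exp f(x, ·)
dη(x), which is again bounded and measurable and so is a valid test function for P and Q. The cost k
need only be integrable under P, which matters because the Gaussian costs are unbounded. -/
lemma EntropyLE.compProd {P Q : Measure α} [IsProbabilityMeasure P] [IsProbabilityMeasure Q]
    {κ η : Kernel α β} [IsMarkovKernel κ] [IsMarkovKernel η] {K : ℝ} {k : α → ℝ}
    (h : EntropyLE P Q K) (hk : Integrable k P) (hκ : ∀ x, EntropyLE (κ x) (η x) (k x)) :
    EntropyLE (P ⊗ₘ κ) (Q ⊗ₘ η) (K + ∫ x, k x ∂P) := by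
  rintro f hf ⟨C, hC⟩
  have hfx : ∀ x, Measurable fun y => f (x, y) := fun x => hf.comp measurable_prodMk_left
  set g : α → ℝ := fun x => Real.log (∫ y, Real.exp (f (x, y)) ∂(η x)) with hg
  have hgm : Measurable g :=
    (hf.exp.stronglyMeasurable.integral_kernel_prod_right' (κ := η)).measurable.log
  have hlow := fun x => exp_neg_le_integral_exp (P := η x) (hfx x) (fun y => hC (x, y))
  have hpos : ∀ x, 0 < ∫ y, Real.exp (f (x, y)) ∂(η x) :=
    fun x => (Real.exp_pos _).trans_le (hlow x)
  have hgC : ∀ x, |g x| ≤ C := fun x => by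
    refine abs_le.2 ⟨(Real.le_log_iff_exp_le (hpos x)).2 (hlow x), ?_⟩
    exact (Real.log_le_iff_le_exp (hpos x)).2
      (integral_exp_le_exp (hfx x) (fun y => hC (x, y)))
  have hgi : Integrable g P := integrable_of_abs_le hgm hgC
  calc ∫ z, f z ∂(P ⊗ₘ κ) = ∫ x, ∫ y, f (x, y) ∂(κ x) ∂P :=
        Measure.integral_compProd (integrable_of_abs_le hf hC)
    _ ≤ ∫ x, (k x + g x) ∂P := by
        refine integral_mono ?_ (hk.add hgi) fun x =>
          hκ x _ (hfx x) ⟨C, fun y => hC (x, y)⟩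
        refine integrable_of_abs_le (C := C)
          (hf.stronglyMeasurable.integral_kernel_prod_right' (κ := κ)).measurable fun x => ?_
        have hn : ∀ᵐ y ∂(κ x), ‖f (x, y)‖ ≤ C := ae_of_all _ fun y => hC (x, y)
        simpa using norm_integral_le_of_norm_le_const hn
    _ = ∫ x, k x ∂P + ∫ x, g x ∂P := integral_add hk hgi
    _ ≤ ∫ x, k x ∂P + (K + Real.log (∫ x, Real.exp (g x) ∂Q)) := by
        gcongr
        exact h g hgm ⟨C, hgC⟩
    _ = _ := by
        rw [Measure.integral_compProd (integrable_exp_of_abs_le hf hC)]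
        simp_rw [hg, fun x => Real.exp_log (hpos x)]
        ring

/-- The change-of-measure bound for an event. -/
lemma EntropyLE.mul_measureReal_le {P Q : Measure α} [IsProbabilityMeasure P]
    [IsProbabilityMeasure Q] {K : ℝ} (h : EntropyLE P Q K) {A : Set α} (hA : MeasurableSet A)
    (s : ℝ) : s * P.real A ≤ K + Real.log (1 + (Real.exp s - 1) * Q.real A) := by
  have h1 := h (A.indicator fun _ => s) (measurable_const.indicator hA)
    ⟨|s|, fun x => by by_cases hx : x ∈ A <;> simp [hx]⟩
  have h2 : ∀ x, Real.exp (A.indicator (fun _ => s) x)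
      = 1 + A.indicator (fun _ => Real.exp s - 1) x := fun x => by
    by_cases hx : x ∈ A <;> simp [hx]
  simp_rw [h2] at h1
  rw [integral_add (integrable_const _) ((integrable_const _).indicator hA),
    integral_indicator_const _ hA, integral_indicator_const _ hA] at h1
  simpa [mul_comm] using h1

/-- Relative entropy of a real Gaussian law with respect to the standard one. -/
lemma entropyLE_gaussianReal (m : ℝ) {v : NNReal} (hv : v ≠ 0) :
    EntropyLE (gaussianReal m v) (gaussianReal 0 1) ((m ^ 2 + v - 1 - Real.log v) / 2) := by
  rintro f hf ⟨C, hC⟩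
  have hv0 : (0 : ℝ) < v := by positivity
  -- g is the log-density of N(0, 1) relative to N(m, v). Jensen for f + g under N(m, v) is the
  -- claim, since the mean of g is minus the stated entropy.
  set g : ℝ → ℝ := fun x => Real.log v / 2 - x ^ 2 / 2 + (x - m) ^ 2 / (2 * v) with hg
  have hpdf : ∀ x, gaussianPDFReal m v x * Real.exp (f x + g x)
      = gaussianPDFReal 0 1 x * Real.exp (f x) := fun x => by
    have hs : Real.exp (Real.log v / 2) = √(v : ℝ) := by
      rw [Real.sqrt_eq_rpow, Real.rpow_def_of_pos hv0]; ring_nf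
    have h2 : √(2 * Real.pi * v) = √(2 * Real.pi) * √(v : ℝ) := Real.sqrt_mul (by positivity) _
    have hsv : √(v : ℝ) ≠ 0 := by positivity
    have hsp : √(2 * Real.pi) ≠ 0 := by positivity
    have he : Real.exp (f x + g x) = Real.exp (f x) * √(v : ℝ) * Real.exp (-(x ^ 2 / 2)) *
        Real.exp ((x - m) ^ 2 / (2 * v)) := by
      rw [← hs, ← Real.exp_add, ← Real.exp_add, ← Real.exp_add]; simp only [hg]; ring_nf
    have hn : Real.exp (-(x - m) ^ 2 / (2 * v)) = (Real.exp ((x - m) ^ 2 / (2 * v)))⁻¹ := by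
      rw [← Real.exp_neg]; ring_nf
    have h0 : Real.exp (-(x - 0) ^ 2 / (2 * ((1 : NNReal) : ℝ))) = Real.exp (-(x ^ 2 / 2)) := by
      congr 1; push_cast; ring
    rw [gaussianPDFReal, gaussianPDFReal, h2, he, hn, h0, NNReal.coe_one, mul_one]
    have := (Real.exp_pos ((x - m) ^ 2 / (2 * v))).ne'
    field_simp
  have hint : ∫ x, Real.exp (f x) ∂(gaussianReal 0 1)
      = ∫ x, Real.exp (f x + g x) ∂(gaussianReal m v) := by
    rw [integral_gaussianReal_eq_integral_smul one_ne_zero,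
      integral_gaussianReal_eq_integral_smul hv]
    simp only [smul_eq_mul, hpdf]
  have hie : Integrable (fun x => Real.exp (f x + g x)) (gaussianReal m v) := by
    have h1 := integrable_exp_of_abs_le (P := gaussianReal 0 1) hf hC
    rw [gaussianReal_of_var_ne_zero _ one_ne_zero,
      integrable_withDensity_iff_integrable_smul' (measurable_gaussianPDF _ _)
        (ae_of_all _ fun x => gaussianPDF_lt_top)] at h1
    rw [gaussianReal_of_var_ne_zero _ hv,
      integrable_withDensity_iff_integrable_smul' (measurable_gaussianPDF _ _)
        (ae_of_all _ fun x => gaussianPDF_lt_top)]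
    simpa only [toReal_gaussianPDF, smul_eq_mul, hpdf] using h1
  have hx2 : MemLp (fun x : ℝ => x) 2 (gaussianReal m v) := IsGaussian.memLp_two_id
  have hx2' : Integrable (fun x : ℝ => x ^ 2) (gaussianReal m v) := hx2.integrable_sq
  have hxm : Integrable (fun x : ℝ => (x - m) ^ 2) (gaussianReal m v) :=
    (hx2.sub (memLp_const m)).integrable_sq
  have hvar : ∫ x, (x - m) ^ 2 ∂(gaussianReal m v) = v := by
    have := variance_fun_id_gaussianReal (μ := m) (v := v)
    rw [variance_eq_integral measurable_id'.aemeasurable, integral_id_gaussianReal] at this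
    exact this
  have hsq : ∫ x, x ^ 2 ∂(gaussianReal m v) = m ^ 2 + v := by
    have := variance_fun_id_gaussianReal (μ := m) (v := v)
    rw [variance_eq_sub hx2] at this
    simp only [Pi.pow_apply, integral_id_gaussianReal] at this
    linarith
  have hgi : Integrable g (gaussianReal m v) :=
    ((integrable_const _).sub (hx2'.div_const 2)).add (hxm.div_const _)
  have hgint : ∫ x, g x ∂(gaussianReal m v) = -((m ^ 2 + v - 1 - Real.log v) / 2) := by
    have e1 : ∫ x, g x ∂(gaussianReal m v) = ∫ x, (Real.log v / 2 - x ^ 2 / 2) ∂(gaussianReal m v)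
        + ∫ x, (x - m) ^ 2 / (2 * v) ∂(gaussianReal m v) :=
      integral_add ((integrable_const _).sub (hx2'.div_const 2)) (hxm.div_const _)
    rw [e1, integral_sub (integrable_const _) (hx2'.div_const 2), integral_div, integral_div,
      integral_div, hvar, hsq]
    simp only [integral_const, probReal_univ, smul_eq_mul]
    field_simp
    ring
  have hfi := integrable_of_abs_le (P := gaussianReal m v) hf hC
  have key := integral_le_log_integral_exp (hfi.add hgi) hie
  rw [hint]
  have e2 : ∫ x, (f + g) x ∂(gaussianReal m v) = ∫ x, f x ∂(gaussianReal m v)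
      + ∫ x, g x ∂(gaussianReal m v) := integral_add hfi hgi
  rw [e2, hgint] at key
  simp only [Pi.add_apply] at key
  linarith

end Entropy

/-! ### The model with a single correlated pair and its one-site updates -/

section Pair

variable {p : ℕ}

/-- The covariance matrix with unit variances in which only the coordinates `a` and `b` are
correlated, with correlation `ρ`. -/
def pairCov (ρ : ℝ) (a b : Fin p) : Matrix (Fin p) (Fin p) ℝ :=
  1 + ρ • (Matrix.single a b 1 + Matrix.single b a 1)

/-- The inverse of `pairCov ρ a b`. -/
def pairPrec (ρ : ℝ) (a b : Fin p) : Matrix (Fin p) (Fin p) ℝ :=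
  1 + (ρ ^ 2 / (1 - ρ ^ 2)) • (Matrix.single a a 1 + Matrix.single b b 1)
    - (ρ / (1 - ρ ^ 2)) • (Matrix.single a b 1 + Matrix.single b a 1)

variable {ρ : ℝ} {a b : Fin p}

lemma pairCov_mul_pairPrec (hab : a ≠ b) (hρ : ρ ^ 2 < 1) :
    pairCov ρ a b * pairPrec ρ a b = 1 := by
  have h : 1 - ρ ^ 2 ≠ 0 := by linarith
  have e : pairCov ρ a b * pairPrec ρ a b = 1 +
      (ρ ^ 2 / (1 - ρ ^ 2) - ρ * (ρ / (1 - ρ ^ 2))) •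
        (Matrix.single a a 1 + Matrix.single b b 1) +
      (ρ - ρ / (1 - ρ ^ 2) + ρ * (ρ ^ 2 / (1 - ρ ^ 2))) •
        (Matrix.single a b 1 + Matrix.single b a 1) := by
    simp only [pairCov, pairPrec, mul_sub, mul_add, add_mul, one_mul, mul_one, smul_mul_assoc,
      mul_smul_comm, Matrix.single_mul_single_same, Matrix.single_mul_single_of_ne, hab, hab.symm,
      ne_eq, not_false_eq_true, smul_add, smul_smul]
    module
  have e1 : ρ ^ 2 / (1 - ρ ^ 2) - ρ * (ρ / (1 - ρ ^ 2)) = 0 := by ring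
  have e2 : ρ - ρ / (1 - ρ ^ 2) + ρ * (ρ ^ 2 / (1 - ρ ^ 2)) = 0 := by field_simp; ring
  rw [e, e1, e2]
  simp

lemma inv_pairPrec (hab : a ≠ b) (hρ : ρ ^ 2 < 1) : (pairPrec ρ a b)⁻¹ = pairCov ρ a b :=
  Matrix.inv_eq_left_inv (pairCov_mul_pairPrec hab hρ)

lemma inv_pairCov (hab : a ≠ b) (hρ : ρ ^ 2 < 1) : (pairCov ρ a b)⁻¹ = pairPrec ρ a b :=
  Matrix.inv_eq_right_inv (pairCov_mul_pairPrec hab hρ)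

@[simp] lemma pairPrec_zero : pairPrec 0 a b = 1 := by simp [pairPrec]

@[simp] lemma pairCov_zero : pairCov 0 a b = 1 := by simp [pairCov]

lemma pairPrec_comm : pairPrec ρ a b = pairPrec ρ b a := by
  unfold pairPrec
  rw [add_comm (Matrix.single a a 1), add_comm (Matrix.single a b 1)]

lemma pairCov_apply_self (hab : a ≠ b) (i : Fin p) : pairCov ρ a b i i = 1 := by
  have h1 : ¬(a = i ∧ b = i) := fun h => hab (h.1.trans h.2.symm)
  have h2 : ¬(b = i ∧ a = i) := fun h => hab (h.2.trans h.1.symm)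
  simp [pairCov, h1, h2]

lemma dotProduct_pairCov_mulVec (x : Fin p → ℝ) :
    x ⬝ᵥ (pairCov ρ a b).mulVec x = x ⬝ᵥ x + 2 * ρ * (x a * x b) := by
  simp only [pairCov, Matrix.add_mulVec, Matrix.smul_mulVec, Matrix.one_mulVec, dotProduct_add,
    dotProduct_smul, Matrix.single_mulVec, smul_eq_mul]
  simp [dotProduct, Function.update_apply]
  ring

lemma posDef_pairCov (hab : a ≠ b) (h0 : 0 ≤ ρ) (h1 : ρ < 1) : (pairCov ρ a b).PosDef := by
  refine Matrix.PosDef.of_dotProduct_mulVec_pos ?_ fun x hx => ?_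
  · simp [pairCov, Matrix.IsHermitian, add_comm]
  · rw [star_trivial, dotProduct_pairCov_mulVec]
    have h3 : x a ^ 2 + x b ^ 2 ≤ x ⬝ᵥ x := by
      have := Finset.sum_le_sum_of_subset_of_nonneg (Finset.subset_univ ({a, b} : Finset (Fin p)))
        (f := fun i => x i * x i) fun i _ _ => mul_self_nonneg _
      rw [Finset.sum_pair hab] at this
      simpa [dotProduct, sq] using this
    have h4 : 0 < x ⬝ᵥ x := by
      simpa using (Matrix.dotProduct_star_self_pos_iff (v := x)).2 hx
    -- The form is at least (1 - ρ) x·x, because 2ρ x_a x_b ≥ -ρ(x_a² + x_b²) ≥ -ρ x·x.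
    nlinarith [sq_nonneg (x a + x b), mul_le_mul_of_nonneg_left h3 h0,
      mul_nonneg h0 (sq_nonneg (x a + x b)), mul_pos (sub_pos.2 h1) h4]

lemma posDef_pairPrec (hab : a ≠ b) (h0 : 0 ≤ ρ) (h1 : ρ < 1) : (pairPrec ρ a b).PosDef := by
  rw [← inv_pairCov hab (by nlinarith)]
  exact (posDef_pairCov hab h0 h1).inv

lemma pairPrec_apply_left (hab : a ≠ b) (hρ : ρ ^ 2 < 1) :
    pairPrec ρ a b a a = 1 / (1 - ρ ^ 2) := by
  have h : 1 - ρ ^ 2 ≠ 0 := by linarith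
  simp [pairPrec, hab.symm]
  field_simp
  ring

lemma pairPrec_apply_left_right (hab : a ≠ b) : pairPrec ρ a b a b = -(ρ / (1 - ρ ^ 2)) := by
  simp [pairPrec, hab, hab.symm]

lemma pairPrec_apply_of_ne {i j : Fin p} (hij : i ≠ j) (h : ¬(i = a ∧ j = b))
    (h' : ¬(i = b ∧ j = a)) : pairPrec ρ a b i j = 0 := by
  have h1 : ¬(i = a ∧ j = a) := fun h => hij (h.1.trans h.2.symm)
  have h2 : ¬(i = b ∧ j = b) := fun h => hij (h.1.trans h.2.symm)
  simp [pairPrec, h1, h2, hij, eq_comm (a := a), eq_comm (a := b), h, h']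

lemma pairPrec_apply_self_of_ne {i : Fin p} (ha : i ≠ a) (hb : i ≠ b) :
    pairPrec ρ a b i i = 1 := by
  simp [pairPrec, ha.symm, hb.symm]

lemma supportGraph_pairPrec_adj (hab : a ≠ b) (h0 : ρ ≠ 0) (hρ : ρ ^ 2 < 1) {i j : Fin p} :
    (supportGraph (pairPrec ρ a b)).Adj i j ↔ (i = a ∧ j = b) ∨ (i = b ∧ j = a) := by
  have h : 1 - ρ ^ 2 ≠ 0 := by linarith
  have hd : -(ρ / (1 - ρ ^ 2)) ≠ 0 := neg_ne_zero.2 (div_ne_zero h0 h)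
  rw [supportGraph, SimpleGraph.fromRel_adj]
  constructor
  · rintro ⟨hij, h1⟩
    by_contra hc
    push Not at hc
    rcases h1 with h1 | h1
    · exact h1 (pairPrec_apply_of_ne hij (fun h => hc.1 h.1 h.2) (fun h => hc.2 h.1 h.2))
    · exact h1 (pairPrec_apply_of_ne hij.symm (fun h => hc.2 h.2 h.1) (fun h => hc.1 h.2 h.1))
  · rintro (⟨rfl, rfl⟩ | ⟨rfl, rfl⟩)
    · exact ⟨hab, Or.inl (by rwa [pairPrec_apply_left_right hab])⟩
    · exact ⟨hab.symm, Or.inr (by rwa [pairPrec_apply_left_right hab])⟩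

lemma abs_pairPrec_div (hab : a ≠ b) (h0 : 0 ≤ ρ) (h1 : ρ < 1) :
    |pairPrec ρ a b a b| / pairPrec ρ a b a a = ρ := by
  have h : 0 < 1 - ρ ^ 2 := by nlinarith
  rw [pairPrec_apply_left_right hab, pairPrec_apply_left hab (by linarith), abs_neg,
    abs_of_nonneg (by positivity)]
  field_simp

lemma pairPrec_mem_precisionClass {d : ℕ} (hd : 1 ≤ d) (hab : a ≠ b) (h0 : 0 < ρ) (h1 : ρ < 1) :
    pairPrec ρ a b ∈ precisionClass p d ρ := by
  have hρ : ρ ^ 2 < 1 := by nlinarith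
  refine ⟨posDef_pairPrec hab h0.le h1, fun i => le_trans ?_ hd, fun i j hij => ?_⟩
  · rw [Set.ncard_le_one]
    intro x hx y hy
    rw [SimpleGraph.mem_neighborSet, supportGraph_pairPrec_adj hab h0.ne' hρ] at hx hy
    grind
  · rcases (supportGraph_pairPrec_adj hab h0.ne' hρ).1 hij with ⟨rfl, rfl⟩ | ⟨rfl, rfl⟩
    · exact (abs_pairPrec_div hab h0.le h1).ge
    · rw [pairPrec_comm]
      exact (abs_pairPrec_div hab.symm h0.le h1).ge

lemma condMean_pairPrec_left (hab : a ≠ b) (hρ : ρ ^ 2 < 1) (x : State p) :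
    condMean (pairPrec ρ a b) a x = ρ * x b := by
  have h : 1 - ρ ^ 2 ≠ 0 := by linarith
  rw [condMean, Finset.sum_eq_single b]
  · rw [pairPrec_apply_left_right hab, pairPrec_apply_left hab hρ]
    field_simp
  · intro j hj hjb
    rw [pairPrec_apply_of_ne (Finset.ne_of_mem_erase hj).symm (by tauto) (by tauto)]
    simp
  · intro h
    exact absurd (Finset.mem_erase.2 ⟨hab.symm, Finset.mem_univ _⟩) h

lemma condMean_pairPrec_of_ne {i : Fin p} (ha : i ≠ a) (hb : i ≠ b) (x : State p) :
    condMean (pairPrec ρ a b) i x = 0 :=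
  Finset.sum_eq_zero fun j hj => by
    rw [pairPrec_apply_of_ne (Finset.ne_of_mem_erase hj).symm (by tauto) (by tauto)]
    simp

lemma siteKernel_apply (Θ : Matrix (Fin p) (Fin p) ℝ) (x : State p) (i : Fin p) :
    siteKernel Θ (x, i)
      = (gaussianReal (condMean Θ i x) (1 / Θ i i).toNNReal).map (setCoord x i) := rfl

lemma measurable_setCoord_right (x : State p) (i : Fin p) : Measurable (setCoord x i) :=
  (measurable_setCoord i).comp measurable_prodMk_left

lemma siteKernel_pairPrec_left (hab : a ≠ b) (hρ : ρ ^ 2 < 1) (x : State p) :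
    siteKernel (pairPrec ρ a b) (x, a)
      = (gaussianReal (ρ * x b) (1 - ρ ^ 2).toNNReal).map (setCoord x a) := by
  rw [siteKernel_apply, condMean_pairPrec_left hab hρ, pairPrec_apply_left hab hρ, one_div_one_div]

lemma siteKernel_pairPrec_of_ne {i : Fin p} (ha : i ≠ a) (hb : i ≠ b) (x : State p) :
    siteKernel (pairPrec ρ a b) (x, i) = (gaussianReal 0 1).map (setCoord x i) := by
  rw [siteKernel_apply, condMean_pairPrec_of_ne ha hb, pairPrec_apply_self_of_ne ha hb]
  simp

lemma siteKernel_one (i : Fin p) (x : State p) :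
    siteKernel (1 : Matrix (Fin p) (Fin p) ℝ) (x, i) = (gaussianReal 0 1).map (setCoord x i) := by
  rw [siteKernel_apply, condMean, Finset.sum_eq_zero]
  · simp
  · intro j hj
    simp [Matrix.one_apply_ne (Finset.ne_of_mem_erase hj).symm]

/-- An upper bound for the relative entropy of `N(ρ y, 1 - ρ ^ 2)` with respect to `N(0, 1)`. -/
def pairCost (ρ y : ℝ) : ℝ := ρ ^ 2 / 2 * y ^ 2 + ρ ^ 4 / (2 * (1 - ρ ^ 2))

lemma entropyLE_pairCost (hρ : ρ ^ 2 < 1) (y : ℝ) :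
    EntropyLE (gaussianReal (ρ * y) (1 - ρ ^ 2).toNNReal) (gaussianReal 0 1) (pairCost ρ y) := by
  have h : 0 < 1 - ρ ^ 2 := by linarith
  refine (entropyLE_gaussianReal (ρ * y) (v := (1 - ρ ^ 2).toNNReal) (by simpa using h)).mono ?_
  rw [Real.coe_toNNReal _ h.le, pairCost]
  -- Using -log v ≤ 1/v - 1 at v = 1 - ρ² makes the cost rational in ρ; when y has second moment 1
  -- its mean is exactly ρ²/(2(1 - ρ²)).
  have hl := Real.one_sub_inv_le_log_of_pos h
  have e : ρ ^ 4 / (2 * (1 - ρ ^ 2)) = ((1 - ρ ^ 2)⁻¹ - 1 - ρ ^ 2) / 2 := by field_simp; ring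
  rw [e]
  linarith

lemma entropyLE_siteKernel_left (hab : a ≠ b) (hρ : ρ ^ 2 < 1) (x : State p) :
    EntropyLE (siteKernel (pairPrec ρ a b) (x, a)) (siteKernel 1 (x, a)) (pairCost ρ (x b)) := by
  rw [siteKernel_pairPrec_left hab hρ, siteKernel_one]
  exact (entropyLE_pairCost hρ _).map (measurable_setCoord_right x a)

lemma entropyLE_siteKernel (hab : a ≠ b) (hρ : ρ ^ 2 < 1) (x : State p) (i : Fin p) :
    EntropyLE (siteKernel (pairPrec ρ a b) (x, i)) (siteKernel 1 (x, i))
      ((if i = a then pairCost ρ (x b) else 0) + (if i = b then pairCost ρ (x a) else 0)) := by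
  by_cases ha : i = a
  · subst ha
    simpa [hab] using entropyLE_siteKernel_left hab hρ x
  by_cases hb : i = b
  · subst hb
    simpa [ha, pairPrec_comm (a := a)] using entropyLE_siteKernel_left hab.symm hρ x
  rw [siteKernel_pairPrec_of_ne ha hb, siteKernel_one, if_neg ha, if_neg hb, add_zero]
  exact (EntropyLE.refl _).map (measurable_setCoord_right x i)

end Pair

/-! ### The initial law as one resampling step, and second moments along the dynamics -/

section Dynamics

variable {p : ℕ} {ρ : ℝ} {a b : Fin p}

/-- Resampling of the fixed coordinate `i`. -/
def siteKernelAt (Θ : Matrix (Fin p) (Fin p) ℝ) (i : Fin p) : Kernel (State p) (State p) :=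
  (siteKernel Θ).comap (fun x => (x, i)) measurable_prodMk_right

instance (Θ : Matrix (Fin p) (Fin p) ℝ) (i : Fin p) : IsMarkovKernel (siteKernelAt Θ i) := by
  unfold siteKernelAt; infer_instance

/-- Moves the overwriting of a coordinate from the state to the frequency t, so that the
characteristic function of a resampled law factors into the new value and the old state. -/
lemma inner_setCoord (x t : State p) (i : Fin p) (z : ℝ) :
    inner ℝ (setCoord x i z) t = inner ℝ x (setCoord t i 0) + z * t i := by
  simp only [PiLp.inner_apply, setCoord, RCLike.inner_apply, conj_trivial]
  rw [← Finset.add_sum_erase _ _ (Finset.mem_univ i),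
    ← Finset.add_sum_erase (a := i) (f := fun j => Function.update (fun j => t j) i 0 j * x j) _
      (Finset.mem_univ i)]
  simp only [Function.update_self]
  rw [Finset.sum_congr rfl fun j hj => by
    rw [Function.update_of_ne (Finset.ne_of_mem_erase hj)]]
  rw [Finset.sum_congr (g := fun j => Function.update (fun j => t j) i 0 j * x j) rfl fun j hj => by
    rw [Function.update_of_ne (Finset.ne_of_mem_erase hj)]]
  ring

/-- After averaging over the new coordinate a, with mean ρ x_b, the old state is seen at the
frequency t with t_a deleted and ρ t_a added at b. Adding back the conditional variance term (1 -
ρ²) t_a² gives the quadratic form of `pairCov`. -/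
lemma norm_sq_setCoord_add (hab : a ≠ b) (t : State p) :
    ‖setCoord t a 0 + EuclideanSpace.single b (ρ * t a)‖ ^ 2
      = ‖t‖ ^ 2 - (1 - ρ ^ 2) * t a ^ 2 + 2 * ρ * (t a * t b) := by
  have h : inner ℝ (setCoord t a 0) (setCoord t a 0) = inner ℝ t t - t a ^ 2 := by
    have h1 := inner_setCoord t t a (t a)
    have h2 := inner_setCoord t (setCoord t a 0) a 0
    have h3 : setCoord t a (t a) = t := by ext j; simp [setCoord]
    have h4 : setCoord (setCoord t a 0) a 0 = setCoord t a 0 := by ext j; simp [setCoord]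
    rw [h3] at h1
    rw [h4] at h2
    rw [h2, h1]
    ring
  rw [← real_inner_self_eq_norm_sq, ← real_inner_self_eq_norm_sq, inner_add_left, inner_add_right,
    inner_add_right, h, EuclideanSpace.inner_single_left, EuclideanSpace.inner_single_left,
    EuclideanSpace.inner_single_right]
  simp [setCoord, Function.update_of_ne hab.symm]
  ring

/-- The pair model is obtained from the standard Gaussian law by resampling one coordinate. -/
lemma map_snd_stdGaussian_compProd (hab : a ≠ b) (h0 : 0 ≤ ρ) (h1 : ρ < 1) :
    (stdGaussian (State p) ⊗ₘ siteKernelAt (pairPrec ρ a b) a).map Prod.snd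
      = multivariateGaussian 0 (pairCov ρ a b) := by
  have hρ : ρ ^ 2 < 1 := by nlinarith
  have : IsProbabilityMeasure
      ((stdGaussian (State p) ⊗ₘ siteKernelAt (pairPrec ρ a b) a).map Prod.snd) :=
    Measure.isProbabilityMeasure_map measurable_snd.aemeasurable
  refine Measure.ext_of_charFun (funext fun t => ?_)
  rw [charFun_multivariateGaussian (posDef_pairCov hab h0 h1).posSemidef, charFun_apply,
    integral_map measurable_snd.aemeasurable (Measurable.aestronglyMeasurable (by fun_prop)),
    Measure.integral_compProd]
  · have hin : ∀ x : State p, ∫ y, Complex.exp (inner ℝ y t * Complex.I)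
        ∂(siteKernelAt (pairPrec ρ a b) a x)
        = Complex.exp (-((1 - ρ ^ 2 : ℝ) * t a ^ 2 / 2)) *
          Complex.exp (inner ℝ x (setCoord t a 0 + EuclideanSpace.single b (ρ * t a))
            * Complex.I) := fun x => by
      rw [siteKernelAt, Kernel.comap_apply, siteKernel_pairPrec_left hab hρ,
        integral_map (measurable_setCoord_right x a).aemeasurable
          (Measurable.aestronglyMeasurable (by fun_prop))]
      have hz : ∀ z : ℝ, Complex.exp (inner ℝ (setCoord x a z) t * Complex.I)
          = Complex.exp (inner ℝ x (setCoord t a 0) * Complex.I)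
            * Complex.exp (t a * z * Complex.I) := fun z => by
        rw [inner_setCoord, ← Complex.exp_add]
        congr 1
        push_cast
        ring
      simp_rw [hz]
      rw [integral_const_mul, ← charFun_apply_real, charFun_gaussianReal, ← Complex.exp_add,
        ← Complex.exp_add]
      congr 1
      rw [inner_add_right, EuclideanSpace.inner_single_right]
      have : (((1 - ρ ^ 2).toNNReal : ℝ) : ℂ) = ((1 - ρ ^ 2 : ℝ) : ℂ) := by
        rw [Real.coe_toNNReal _ (by linarith)]
      rw [this]
      simp
      ring
    simp_rw [hin]
    rw [integral_const_mul, ← charFun_apply, charFun_stdGaussian, ← Complex.exp_add]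
    congr 1
    rw [← Complex.ofReal_pow ‖_‖, norm_sq_setCoord_add hab, dotProduct_pairCov_mulVec]
    have : ‖t‖ ^ 2 = t.ofLp ⬝ᵥ t.ofLp := by
      rw [← real_inner_self_eq_norm_sq, PiLp.inner_apply]; simp [dotProduct, sq]
    rw [this]
    simp
    ring
  · refine Integrable.of_bound (Measurable.aestronglyMeasurable (by fun_prop)) 1
      (ae_of_all _ fun z => ?_)
    rw [Complex.norm_exp_ofReal_mul_I]

lemma lintegral_sq_gaussianReal (m : ℝ) (v : NNReal) :
    ∫⁻ z, ENNReal.ofReal (z ^ 2) ∂(gaussianReal m v) = ENNReal.ofReal (m ^ 2 + v) := by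
  have hx2 : MemLp (fun x : ℝ => x) 2 (gaussianReal m v) := IsGaussian.memLp_two_id
  have := variance_fun_id_gaussianReal (μ := m) (v := v)
  rw [variance_eq_sub hx2] at this
  simp only [Pi.pow_apply, integral_id_gaussianReal] at this
  rw [← ofReal_integral_eq_lintegral_ofReal hx2.integrable_sq (ae_of_all _ fun _ => sq_nonneg _)]
  congr 1
  linarith

lemma lintegral_sq_pairCov (hab : a ≠ b) (h0 : 0 ≤ ρ) (h1 : ρ < 1) (c : Fin p) :
    ∫⁻ x, ENNReal.ofReal (x c ^ 2) ∂(multivariateGaussian 0 (pairCov ρ a b)) = 1 := by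
  have h := measurePreserving_eval_multivariateGaussian (μ := 0)
    (posDef_pairCov hab h0 h1).posSemidef (i := c)
  rw [h.lintegral_comp (f := fun z => ENNReal.ofReal (z ^ 2)) (by fun_prop),
    lintegral_sq_gaussianReal, pairCov_apply_self hab]
  simp

/-- The new second moment is ρ² E[x_b²] + (1 - ρ²), a convex combination of E[x_b²] and 1. -/
lemma lintegral_sq_siteKernel_left (hab : a ≠ b) (hρ : ρ ^ 2 < 1) (μ : Measure (State p))
    [IsProbabilityMeasure μ] (hb : ∫⁻ x, ENNReal.ofReal (x b ^ 2) ∂μ ≤ 1) :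
    ∫⁻ x, ∫⁻ y, ENNReal.ofReal (y a ^ 2) ∂(siteKernel (pairPrec ρ a b) (x, a)) ∂μ ≤ 1 := by
  have hin : ∀ x : State p, ∫⁻ y, ENNReal.ofReal (y a ^ 2) ∂(siteKernel (pairPrec ρ a b) (x, a))
      = ENNReal.ofReal (ρ ^ 2) * ENNReal.ofReal (x b ^ 2) + ENNReal.ofReal (1 - ρ ^ 2) := fun x => by
    rw [siteKernel_pairPrec_left hab hρ, lintegral_map (by fun_prop) (measurable_setCoord_right x a)]
    simp only [setCoord, Function.update_self]
    rw [lintegral_sq_gaussianReal, Real.coe_toNNReal _ (by linarith), mul_pow,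
      ENNReal.ofReal_add (by positivity) (by linarith), ENNReal.ofReal_mul (by positivity)]
  simp_rw [hin]
  rw [lintegral_add_right _ measurable_const, lintegral_const_mul _ (by fun_prop), lintegral_const,
    measure_univ, mul_one]
  calc _ ≤ ENNReal.ofReal (ρ ^ 2) * 1 + ENNReal.ofReal (1 - ρ ^ 2) := by gcongr
    _ = 1 := by
      rw [mul_one, ← ENNReal.ofReal_add (by positivity) (by linarith)]
      simp

lemma lintegral_sq_siteKernel_of_ne (Θ : Matrix (Fin p) (Fin p) ℝ) {c i : Fin p} (hc : c ≠ i)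
    (x : State p) :
    ∫⁻ y, ENNReal.ofReal (y c ^ 2) ∂(siteKernel Θ (x, i)) = ENNReal.ofReal (x c ^ 2) := by
  rw [siteKernel_apply, lintegral_map (by fun_prop) (measurable_setCoord_right x i)]
  simp [setCoord, Function.update_of_ne hc]

lemma isProbabilityMeasure_uniformOn_univ (i : Fin p) :
    IsProbabilityMeasure (uniformOn (Set.univ : Set (Fin p))) :=
  isProbabilityMeasure_uniformOn Set.finite_univ ⟨i, Set.mem_univ i⟩

lemma isMarkovKernel_glauberKernel (Θ : Matrix (Fin p) (Fin p) ℝ) (i : Fin p) :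
    IsMarkovKernel (glauberKernel Θ) := by
  have := isProbabilityMeasure_uniformOn_univ i
  unfold glauberKernel
  infer_instance

lemma glauberKernel_apply (Θ : Matrix (Fin p) (Fin p) ℝ) (i : Fin p) (x : State p) :
    glauberKernel Θ x = uniformOn (Set.univ : Set (Fin p)) ⊗ₘ Kernel.sectR (siteKernel Θ) x := by
  have := isProbabilityMeasure_uniformOn_univ i
  rw [glauberKernel, Kernel.compProd_apply_eq_compProd_sectR, Kernel.const_apply]

/-- Second moments of both correlated coordinates stay bounded by `1` along the dynamics. -/
lemma lintegral_sq_glauberKernel_left (hab : a ≠ b) (hρ : ρ ^ 2 < 1) (μ : Measure (State p))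
    [IsProbabilityMeasure μ] (ha : ∫⁻ x, ENNReal.ofReal (x a ^ 2) ∂μ ≤ 1)
    (hb : ∫⁻ x, ENNReal.ofReal (x b ^ 2) ∂μ ≤ 1) :
    ∫⁻ x, ∫⁻ y, ENNReal.ofReal (y.2 a ^ 2) ∂(glauberKernel (pairPrec ρ a b) x) ∂μ ≤ 1 := by
  have := isProbabilityMeasure_uniformOn_univ a
  have hm : Measurable fun q : State p × Fin p =>
      ∫⁻ y, ENNReal.ofReal (y a ^ 2) ∂(siteKernel (pairPrec ρ a b) q) :=
    Measurable.lintegral_kernel (by fun_prop)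
  have hin : ∀ x : State p,
      ∫⁻ y, ENNReal.ofReal (y.2 a ^ 2) ∂(glauberKernel (pairPrec ρ a b) x)
        = ∫⁻ i, ∫⁻ y, ENNReal.ofReal (y a ^ 2) ∂(siteKernel (pairPrec ρ a b) (x, i))
          ∂(uniformOn (Set.univ : Set (Fin p))) := fun x => by
    rw [glauberKernel_apply _ a, Measure.lintegral_compProd (by fun_prop)]
    simp only [Kernel.sectR_apply]
  simp_rw [hin]
  rw [lintegral_lintegral_swap hm.aemeasurable]
  calc _ ≤ ∫⁻ _, 1 ∂(uniformOn (Set.univ : Set (Fin p))) := by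
        refine lintegral_mono fun i => ?_
        by_cases hi : i = a
        · subst hi
          exact lintegral_sq_siteKernel_left hab hρ μ hb
        · simpa only [lintegral_sq_siteKernel_of_ne _ (Ne.symm hi)] using ha
    _ = 1 := by simp

lemma measurable_snoc {n : ℕ} :
    Measurable fun q : (Data p n × State p) × (Fin p × State p) =>
      ((Fin.snoc (α := fun _ => Fin p × State p) q.1.1 q.2, q.2.2) : Data p (n + 1) × State p) := by
  refine Measurable.prodMk (measurable_pi_lambda _ fun j => ?_) (by fun_prop)
  refine Fin.lastCases ?_ (fun j => ?_) j
  · simpa using measurable_snd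
  · simp only [Fin.snoc_castSucc]
    fun_prop

lemma isProbabilityMeasure_glauberJoint (Θ : Matrix (Fin p) (Fin p) ℝ) (i : Fin p) (n : ℕ) :
    IsProbabilityMeasure (glauberJoint Θ n) := by
  have := isMarkovKernel_glauberKernel Θ i
  induction n with
  | zero => exact Measure.isProbabilityMeasure_map (Measurable.aemeasurable (by fun_prop))
  | succ n ih =>
    exact Measure.isProbabilityMeasure_map measurable_snoc.aemeasurable

/-- Only this bound is needed from stationarity, so it is propagated by induction in place of
invariance of the Gaussian law. Lower integrals make the induction free of integrability conditions,
which later follow from the bound. -/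
lemma lintegral_sq_glauberJoint (hab : a ≠ b) (h0 : 0 ≤ ρ) (h1 : ρ < 1) (n : ℕ) :
    ∫⁻ q, ENNReal.ofReal (q.2 a ^ 2) ∂(glauberJoint (pairPrec ρ a b) n) ≤ 1 ∧
      ∫⁻ q, ENNReal.ofReal (q.2 b ^ 2) ∂(glauberJoint (pairPrec ρ a b) n) ≤ 1 := by
  have hρ : ρ ^ 2 < 1 := by nlinarith
  have := isMarkovKernel_glauberKernel (pairPrec ρ a b) a
  induction n with
  | zero =>
    have hf : Measurable fun x : State p => ((Fin.elim0, x) : Data p 0 × State p) := by fun_prop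
    simp only [glauberJoint, inv_pairPrec hab hρ]
    rw [lintegral_map (by fun_prop) hf, lintegral_map (by fun_prop) hf]
    exact ⟨(lintegral_sq_pairCov hab h0 h1 a).le, (lintegral_sq_pairCov hab h0 h1 b).le⟩
  | succ n ih =>
    have hP := isProbabilityMeasure_glauberJoint (pairPrec ρ a b) a n
    set μ := (glauberJoint (pairPrec ρ a b) n).map Prod.snd with hμ
    have hμP : IsProbabilityMeasure μ :=
      Measure.isProbabilityMeasure_map measurable_snd.aemeasurable
    have hma : ∀ c, ∫⁻ x, ENNReal.ofReal (x c ^ 2) ∂μ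
        = ∫⁻ q, ENNReal.ofReal (q.2 c ^ 2) ∂(glauberJoint (pairPrec ρ a b) n) := fun c => by
      rw [hμ, lintegral_map (by fun_prop) measurable_snd]
    have hstep : ∀ c, ∫⁻ q, ENNReal.ofReal (q.2 c ^ 2) ∂(glauberJoint (pairPrec ρ a b) (n + 1))
        = ∫⁻ x, ∫⁻ y, ENNReal.ofReal (y.2 c ^ 2) ∂(glauberKernel (pairPrec ρ a b) x) ∂μ :=
      fun c => by
      rw [glauberJoint, lintegral_map (by fun_prop) measurable_snoc,
        Measure.lintegral_compProd (by fun_prop), hμ,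
        lintegral_map (Measurable.lintegral_kernel (by fun_prop)) measurable_snd]
      rfl
    rw [hstep, hstep]
    rw [← hma, ← hma] at ih
    refine ⟨lintegral_sq_glauberKernel_left hab hρ μ ih.1 ih.2, ?_⟩
    rw [pairPrec_comm]
    exact lintegral_sq_glauberKernel_left hab.symm hρ μ ih.2 ih.1

end Dynamics

/-! ### Relative entropy accumulated by the data -/

section Information

variable {p : ℕ} {ρ : ℝ} {a b : Fin p}

lemma integrable_pairCost {Ω : Type*} [MeasurableSpace Ω] {μ : Measure Ω} [IsProbabilityMeasure μ]
    {X : Ω → ℝ} (hX : Measurable X) (h : ∫⁻ ω, ENNReal.ofReal (X ω ^ 2) ∂μ ≤ 1) (ρ : ℝ) :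
    Integrable (fun ω => pairCost ρ (X ω)) μ := by
  have : Integrable (fun ω => X ω ^ 2) μ :=
    (lintegral_ofReal_ne_top_iff_integrable (hX.pow_const 2).aestronglyMeasurable
      (ae_of_all _ fun _ => sq_nonneg _)).1 (h.trans_lt ENNReal.one_lt_top).ne
  exact (this.const_mul _).add (integrable_const _)

lemma integral_pairCost_le {Ω : Type*} [MeasurableSpace Ω] {μ : Measure Ω} [IsProbabilityMeasure μ]
    {X : Ω → ℝ} (hX : Measurable X) (h : ∫⁻ ω, ENNReal.ofReal (X ω ^ 2) ∂μ ≤ 1)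
    (hρ : ρ ^ 2 < 1) : ∫ ω, pairCost ρ (X ω) ∂μ ≤ ρ ^ 2 / (2 * (1 - ρ ^ 2)) := by
  have hi : Integrable (fun ω => X ω ^ 2) μ :=
    (lintegral_ofReal_ne_top_iff_integrable (hX.pow_const 2).aestronglyMeasurable
      (ae_of_all _ fun _ => sq_nonneg _)).1 (h.trans_lt ENNReal.one_lt_top).ne
  have h1 : ∫ ω, X ω ^ 2 ∂μ ≤ 1 := by
    rw [← ofReal_integral_eq_lintegral_ofReal hi (ae_of_all _ fun _ => sq_nonneg _)] at h
    exact ENNReal.ofReal_le_one.1 h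
  simp only [pairCost]
  rw [integral_add (hi.const_mul _) (integrable_const _), integral_const_mul]
  simp only [integral_const, probReal_univ, one_smul]
  have h2 : 0 < 1 - ρ ^ 2 := by linarith
  have e : ρ ^ 2 / (2 * (1 - ρ ^ 2)) = ρ ^ 2 / 2 * 1 + ρ ^ 4 / (2 * (1 - ρ ^ 2)) := by
    field_simp; ring
  rw [e]
  gcongr

lemma integral_uniformOn_univ (f : Fin p → ℝ) :
    ∫ i, f i ∂(uniformOn (Set.univ : Set (Fin p))) = (∑ i, f i) / p := by
  -- For p = 0 the space is empty and the right side is 0 / 0 = 0.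
  rcases Nat.eq_zero_or_pos p with rfl | hp
  · simp [Measure.eq_zero_of_isEmpty]
  have := isProbabilityMeasure_uniformOn_univ (⟨0, hp⟩ : Fin p)
  rw [integral_fintype Integrable.of_finite, Finset.sum_div]
  refine Finset.sum_congr rfl fun i _ => ?_
  have : (uniformOn (Set.univ : Set (Fin p))).real {i} = 1 / p := by
    rw [measureReal_def, uniformOn_univ]
    simp
  rw [this, smul_eq_mul]
  ring

/-- The choice of site has the same law in both models and costs nothing; averaging the site costs
leaves only the two endpoints, each with weight 1/p. -/
lemma entropyLE_glauberKernel (hab : a ≠ b) (hρ : ρ ^ 2 < 1) (x : State p) :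
    EntropyLE (glauberKernel (pairPrec ρ a b) x) (glauberKernel 1 x)
      ((pairCost ρ (x b) + pairCost ρ (x a)) / p) := by
  have := isProbabilityMeasure_uniformOn_univ a
  rw [glauberKernel_apply _ a, glauberKernel_apply _ a]
  refine ((EntropyLE.refl _).compProd Integrable.of_finite fun i => ?_).mono
    (K := 0 + ∫ i, ((if i = a then pairCost ρ (x b) else 0)
      + (if i = b then pairCost ρ (x a) else 0)) ∂(uniformOn (Set.univ : Set (Fin p)))) ?_
  · simp only [Kernel.sectR_apply]
    exact entropyLE_siteKernel hab hρ x i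
  · rw [integral_uniformOn_univ]
    simp [Finset.sum_add_distrib]

lemma entropyLE_multivariateGaussian (hab : a ≠ b) (h0 : 0 ≤ ρ) (h1 : ρ < 1) :
    EntropyLE (multivariateGaussian 0 (pairCov ρ a b)) (multivariateGaussian 0 1)
      (ρ ^ 2 / (2 * (1 - ρ ^ 2))) := by
  have hρ : ρ ^ 2 < 1 := by nlinarith
  -- At ρ = 0 the same construction yields the standard Gaussian. Both laws thus arise from one
  -- starting law by resampling coordinate a, and their entropy is at most the mean cost of that
  -- step.
  have hQ := map_snd_stdGaussian_compProd hab le_rfl one_pos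
  rw [pairPrec_zero, pairCov_zero] at hQ
  have hb : ∫⁻ x, ENNReal.ofReal (x b ^ 2) ∂(stdGaussian (State p)) ≤ 1 := by
    have := (lintegral_sq_pairCov hab le_rfl one_pos b).le
    rwa [pairCov_zero, multivariateGaussian_zero_one] at this
  rw [← hQ, ← map_snd_stdGaussian_compProd hab h0 h1]
  refine EntropyLE.map (EntropyLE.mono ?_ (integral_pairCost_le (by fun_prop) hb hρ)) measurable_snd
  rw [← zero_add (∫ x : State p, _ ∂_)]
  exact (EntropyLE.refl _).compProd (integrable_pairCost (by fun_prop) hb ρ)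
    fun x => entropyLE_siteKernel_left hab hρ x

lemma entropyLE_glauberJoint (hab : a ≠ b) (h0 : 0 ≤ ρ) (h1 : ρ < 1) (n : ℕ) :
    EntropyLE (glauberJoint (pairPrec ρ a b) n) (glauberJoint 1 n)
      (ρ ^ 2 / (2 * (1 - ρ ^ 2)) * (1 + 2 * n / p)) := by
  have hρ : ρ ^ 2 < 1 := by nlinarith
  have := isMarkovKernel_glauberKernel (pairPrec ρ a b) a
  have := isMarkovKernel_glauberKernel (1 : Matrix (Fin p) (Fin p) ℝ) a
  induction n with
  | zero =>
    simp only [glauberJoint, inv_pairPrec hab hρ, inv_one]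
    refine EntropyLE.map ?_ (by fun_prop)
    simpa using entropyLE_multivariateGaussian hab h0 h1
  | succ n ih =>
    have := isProbabilityMeasure_glauberJoint (pairPrec ρ a b) a n
    have := isProbabilityMeasure_glauberJoint (1 : Matrix (Fin p) (Fin p) ℝ) a n
    obtain ⟨ha, hb⟩ := lintegral_sq_glauberJoint hab h0 h1 n
    have ia := integrable_pairCost (by fun_prop) ha ρ
    have ib := integrable_pairCost (by fun_prop) hb ρ
    rw [glauberJoint, glauberJoint]
    refine EntropyLE.map (EntropyLE.mono (ih.compProd ((ib.add ia).div_const (p : ℝ))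
      fun q => entropyLE_glauberKernel hab hρ q.2) ?_) measurable_snoc
    rw [integral_div]
    have e : ∫ q, ((fun q : Data p n × State p => pairCost ρ (q.2 b)) +
        fun q : Data p n × State p => pairCost ρ (q.2 a)) q
        ∂(glauberJoint (pairPrec ρ a b) n) ≤ 2 * (ρ ^ 2 / (2 * (1 - ρ ^ 2))) := by
      rw [integral_add' ib ia]
      linarith [integral_pairCost_le (by fun_prop) ha hρ, integral_pairCost_le (by fun_prop) hb hρ]
    calc _ ≤ ρ ^ 2 / (2 * (1 - ρ ^ 2)) * (1 + 2 * n / p)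
          + 2 * (ρ ^ 2 / (2 * (1 - ρ ^ 2))) / p := by gcongr
      _ = _ := by push_cast; ring

lemma isProbabilityMeasure_dataLaw (Θ : Matrix (Fin p) (Fin p) ℝ) (i : Fin p) (n : ℕ) :
    IsProbabilityMeasure (dataLaw Θ n) :=
  have := isProbabilityMeasure_glauberJoint Θ i n
  Measure.isProbabilityMeasure_map measurable_fst.aemeasurable

lemma entropyLE_dataLaw (hab : a ≠ b) (h0 : 0 ≤ ρ) (h1 : ρ < 1) (n : ℕ) :
    EntropyLE (dataLaw (pairPrec ρ a b) n) (dataLaw 1 n)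
      (ρ ^ 2 / (2 * (1 - ρ ^ 2)) * (1 + 2 * n / p)) :=
  (entropyLE_glauberJoint hab h0 h1 n).map measurable_fst

end Information

/-! ### Fano-type argument over the edges of a cycle -/

section Estimation

/-- The successor of a vertex in the cyclic order. -/
def cyclicSucc {p : ℕ} (i : Fin p) : Fin p := ⟨(i + 1) % p, Nat.mod_lt _ i.pos⟩

lemma ne_cyclicSucc {p : ℕ} (hp : 2 ≤ p) (i : Fin p) : i ≠ cyclicSucc i := by
  intro h
  have h1 : (i : ℕ) = (i + 1) % p := congrArg Fin.val h
  have h2 := i.isLt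
  rcases Nat.lt_or_ge (i + 1) p with h3 | h3
  · rw [Nat.mod_eq_of_lt h3] at h1; omega
  · have : (i : ℕ) + 1 = p := by omega
    rw [this, Nat.mod_self] at h1; omega

/-- Excludes that two vertices are successors of each other, which happens for p = 2 and would make
two cycle edges coincide. -/
lemma cyclicSucc_ne_of_eq_cyclicSucc {p : ℕ} (hp : 3 ≤ p) {i j : Fin p} (h1 : i = cyclicSucc j) :
    cyclicSucc i ≠ j := by
  subst h1
  intro h
  have h1 : (((j + 1) % p + 1) % p) = (j : ℕ) := congrArg Fin.val h
  have h2 := j.isLt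
  rcases Nat.lt_or_ge (j + 1) p with h3 | h3
  · rw [Nat.mod_eq_of_lt h3] at h1
    rcases Nat.lt_or_ge (j + 1 + 1) p with h4 | h4
    · rw [Nat.mod_eq_of_lt h4] at h1; omega
    · have : (j : ℕ) + 1 + 1 = p := by omega
      rw [this, Nat.mod_self] at h1; omega
  · have : (j : ℕ) + 1 = p := by omega
    rw [this, Nat.mod_self, Nat.mod_eq_of_lt (by omega)] at h1; omega

/-- The precision matrices whose graphs are the single edges of the cycle. -/
def cyclePrec {p : ℕ} (ρ : ℝ) (i : Fin p) : Matrix (Fin p) (Fin p) ℝ :=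
  pairPrec ρ i (cyclicSucc i)

lemma supportGraph_cyclePrec_injective {p : ℕ} (hp : 3 ≤ p) {ρ : ℝ} (h0 : 0 < ρ) (h1 : ρ < 1) :
    Function.Injective fun i : Fin p => supportGraph (cyclePrec ρ i) := by
  intro i j hij
  have hρ : ρ ^ 2 < 1 := by nlinarith
  have hi : (supportGraph (cyclePrec ρ i)).Adj i (cyclicSucc i) :=
    (supportGraph_pairPrec_adj (ne_cyclicSucc (by omega) i) h0.ne' hρ).2 (Or.inl ⟨rfl, rfl⟩)
  simp only at hij
  rw [hij, cyclePrec, supportGraph_pairPrec_adj (ne_cyclicSucc (by omega) j) h0.ne' hρ] at hi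
  rcases hi with h | h
  · exact h.1
  · exact absurd h.2 (cyclicSucc_ne_of_eq_cyclicSucc hp h.1)

lemma half_le_of_maxError_le {p d n : ℕ} {lam : ℝ} {Ψ : Data p n → SimpleGraph (Fin p)}
    (hΨ : ∀ G : SimpleGraph (Fin p), MeasurableSet (Ψ ⁻¹' {G}))
    (h : maxError p d lam n Ψ ≤ 1 / 2) {Θ : Matrix (Fin p) (Fin p) ℝ}
    (hΘ : Θ ∈ precisionClass p d lam) [IsProbabilityMeasure (dataLaw Θ n)] :
    1 / 2 ≤ (dataLaw Θ n).real (Ψ ⁻¹' {supportGraph Θ}) := by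
  have h1 : dataLaw Θ n (Ψ ⁻¹' {supportGraph Θ})ᶜ ≤ 1 / 2 :=
    (le_iSup₂ (f := fun Θ _ => dataLaw Θ n {D | Ψ D ≠ supportGraph Θ}) Θ hΘ).trans h
  have h2 : (dataLaw Θ n).real (Ψ ⁻¹' {supportGraph Θ})ᶜ ≤ 1 / 2 := by
    have := ENNReal.toReal_mono (by simp) h1
    simpa [measureReal_def] using this
  rw [probReal_compl_eq_one_sub (hΨ _)] at h2
  linarith

/-- A Fano-type inequality for the single-edge models on the cycle. -/
lemma mul_half_le_of_maxError_le {p d n : ℕ} (hp : 3 ≤ p) (hd : 1 ≤ d) {lam : ℝ} (h0 : 0 < lam)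
    (h1 : lam < 1) {Ψ : Data p n → SimpleGraph (Fin p)}
    (hΨ : ∀ G : SimpleGraph (Fin p), MeasurableSet (Ψ ⁻¹' {G}))
    (h : maxError p d lam n Ψ ≤ 1 / 2) {s : ℝ} (hs : 0 ≤ s) :
    s / 2 ≤ lam ^ 2 / (2 * (1 - lam ^ 2)) * (1 + 2 * n / p)
      + Real.log (1 + (Real.exp s - 1) / p) := by
  have hp0 : 0 < p := by omega
  have := isProbabilityMeasure_dataLaw (1 : Matrix (Fin p) (Fin p) ℝ) ⟨0, hp0⟩ n
  have hdisj : Pairwise fun i j : Fin p => Disjoint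
      (Ψ ⁻¹' {supportGraph (cyclePrec lam i)}) (Ψ ⁻¹' {supportGraph (cyclePrec lam j)}) :=
    fun i j hij => Disjoint.preimage _ <| Set.disjoint_singleton.2
      ((supportGraph_cyclePrec_injective hp h0 h1).ne hij)
  have hsum : ∑ i : Fin p, (dataLaw 1 n).real (Ψ ⁻¹' {supportGraph (cyclePrec lam i)})
      ≤ ∑ _i : Fin p, 1 / (p : ℝ) := by
    rw [← measureReal_iUnion_fintype hdisj fun i => hΨ _]
    refine measureReal_le_one.trans (le_of_eq ?_)
    simp [hp0.ne']
  have hne : (Finset.univ : Finset (Fin p)).Nonempty := ⟨⟨0, hp0⟩, Finset.mem_univ _⟩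
  obtain ⟨i, -, hi⟩ := Finset.exists_le_of_sum_le hne hsum
  have hii := ne_cyclicSucc (by omega) i
  have := isProbabilityMeasure_dataLaw (pairPrec lam i (cyclicSucc i)) i n
  have hhalf := half_le_of_maxError_le hΨ h (pairPrec_mem_precisionClass hd hii h0 h1)
  have key := (entropyLE_dataLaw hii h0.le h1 n).mul_measureReal_le
    (hΨ (supportGraph (cyclePrec lam i))) s
  have hes : 0 ≤ Real.exp s - 1 := by linarith [Real.one_le_exp hs]
  have hlog : Real.log (1 + (Real.exp s - 1)
      * (dataLaw 1 n).real (Ψ ⁻¹' {supportGraph (cyclePrec lam i)}))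
        ≤ Real.log (1 + (Real.exp s - 1) / p) := by
    apply Real.log_le_log (by positivity)
    rw [div_eq_mul_one_div]
    gcongr
  have hmul := mul_le_mul_of_nonneg_left hhalf hs
  change s * (1 / 2) ≤ s * (dataLaw (pairPrec lam i (cyclicSucc i)) n).real _ at hmul
  calc s / 2 = s * (1 / 2) := by ring
    _ ≤ _ := hmul
    _ ≤ _ := key
    _ ≤ _ := by gcongr

/-- Without rounds the data space is a single point, so the estimator is constant and cannot return
two different graphs. This supplies T p ≥ 1 in the regime of large λ. -/
lemma ne_zero_of_maxError_le {p d n : ℕ} (hp : 3 ≤ p) (hd : 1 ≤ d) {lam : ℝ} (h0 : 0 < lam)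
    (h1 : lam < 1) {Ψ : Data p n → SimpleGraph (Fin p)}
    (hΨ : ∀ G : SimpleGraph (Fin p), MeasurableSet (Ψ ⁻¹' {G}))
    (h : maxError p d lam n Ψ ≤ 1 / 2) : n ≠ 0 := by
  rintro rfl
  have hval : ∀ i : Fin p, supportGraph (cyclePrec lam i) = Ψ Fin.elim0 := fun i => by
    have := isProbabilityMeasure_dataLaw (pairPrec lam i (cyclicSucc i)) i 0
    have hhalf := half_le_of_maxError_le hΨ h
      (pairPrec_mem_precisionClass hd (ne_cyclicSucc (by omega) i) h0 h1)
    by_contra hc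
    have hempty : Ψ ⁻¹' {supportGraph (pairPrec lam i (cyclicSucc i))} = ∅ := by
      refine Set.eq_empty_of_forall_notMem fun D hD => hc ?_
      rw [Subsingleton.elim Fin.elim0 D]
      exact hD.symm
    rw [hempty, measureReal_empty] at hhalf
    norm_num at hhalf
  have := supportGraph_cyclePrec_injective hp h0 h1
    ((hval ⟨0, by omega⟩).trans (hval ⟨1, by omega⟩).symm)
  simp at this

/-- The observation time is at least of order `lam⁻²`. -/
lemma le_time_mul_sq {p d n : ℕ} (hp : 3 ≤ p) (hd : 1 ≤ d) {lam B T : ℝ} (h0 : 0 < lam)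
    (h1 : lam < 1) (hB : 1 / (1 - lam ^ 2) ≤ B) (hT : T * p = n)
    {Ψ : Data p n → SimpleGraph (Fin p)}
    (hΨ : ∀ G : SimpleGraph (Fin p), MeasurableSet (Ψ ⁻¹' {G}))
    (h : maxError p d lam n Ψ ≤ 1 / 2) :
    Real.exp (-(2 * B + 2)) / (40 * B) ≤ T * lam ^ 2 := by
  have hn : (1 : ℝ) ≤ n := by
    exact_mod_cast Nat.one_le_iff_ne_zero.2 (ne_zero_of_maxError_le hp hd h0 h1 hΨ h)
  have hp3 : (3 : ℝ) ≤ p := by exact_mod_cast hp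
  have hlam : 0 < 1 - lam ^ 2 := by nlinarith
  have hB1 : 1 ≤ B := le_trans (by rw [le_div_iff₀ hlam]; nlinarith) hB
  have hT0 : 0 < T := by
    by_contra hc
    nlinarith
  have fano := fun s hs => mul_half_le_of_maxError_le hp hd h0 h1 hΨ h (s := s) hs
  have hK : lam ^ 2 / (2 * (1 - lam ^ 2)) * (1 + 2 * n / p)
      ≤ B * (lam ^ 2 / 2 + T * lam ^ 2) := by
    rw [← hT]
    have e : lam ^ 2 / (2 * (1 - lam ^ 2)) * (1 + 2 * (T * p) / p)
        = 1 / (1 - lam ^ 2) * (lam ^ 2 / 2 + T * lam ^ 2) := by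
      field_simp
    rw [e]
    gcongr
  by_contra hc
  push Not at hc
  have hexp : Real.exp (-(2 * B + 2)) ≤ 1 := Real.exp_le_one_iff.2 (by linarith)
  have hBT : B * (T * lam ^ 2) < 1 / 40 := by
    rw [lt_div_iff₀ (by positivity)] at hc
    linarith
  rcases le_or_gt (B * lam ^ 2) (1 / 20) with hsmall | hlarge
  · have f := fano (1 / 2) (by norm_num)
    have he : Real.exp (1 / 2) ≤ 1.66 := by
      have h2 : Real.exp (1 / 2) ^ 2 = Real.exp 1 := by
        rw [← Real.exp_nat_mul]; norm_num
      nlinarith [Real.exp_one_lt_d9, Real.exp_pos (1 / 2)]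
    have hl : Real.log (1 + (Real.exp (1 / 2) - 1) / p) ≤ 0.2 := by
      have h3 : 1 + (Real.exp (1 / 2) - 1) / p ≤ 1.22 := by
        have : (Real.exp (1 / 2) - 1) / p ≤ 0.66 / 3 := by
          gcongr
          linarith
        linarith
      have hpos : 0 < 1 + (Real.exp (1 / 2) - 1) / p := by
        have := Real.one_le_exp (show (0 : ℝ) ≤ 1 / 2 by norm_num)
        have : 0 ≤ (Real.exp (1 / 2) - 1) / p := div_nonneg (by linarith) (by linarith)
        linarith
      rw [Real.log_le_iff_le_exp hpos]
      have := Real.quadratic_le_exp_of_nonneg (show (0 : ℝ) ≤ 0.2 by norm_num)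
      linarith
    linarith
  · have f := fano (2 * B + 2) (by linarith)
    have hTp : 1 ≤ T * p := hT.symm ▸ hn
    -- Otherwise p · T λ² · 40B < 1 by the assumed smallness of T λ², although T p ≥ 1 and 40 B λ² >
    -- 2.
    have hexp_le : Real.exp (2 * B + 2) ≤ p := by
      rw [lt_div_iff₀ (by positivity), Real.exp_neg, ← one_div, lt_div_iff₀ (Real.exp_pos _)] at hc
      by_contra hc'
      push Not at hc'
      have h2 : (p : ℝ) * (T * lam ^ 2 * (40 * B)) < 1 := by
        refine lt_of_le_of_lt ?_ hc
        rw [mul_comm]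
        gcongr
      nlinarith [mul_le_mul_of_nonneg_right hTp (show 0 ≤ B * lam ^ 2 by positivity)]
    have hl : Real.log (1 + (Real.exp (2 * B + 2) - 1) / p) ≤ 1 := by
      have h2 : (Real.exp (2 * B + 2) - 1) / p ≤ 1 := by
        rw [div_le_one (by linarith)]; linarith
      have hpos : 0 < 1 + (Real.exp (2 * B + 2) - 1) / p := by
        have := Real.one_le_exp (show (0 : ℝ) ≤ 2 * B + 2 by linarith)
        have : 0 ≤ (Real.exp (2 * B + 2) - 1) / p := div_nonneg (by linarith) (by linarith)
        linarith
      rw [Real.log_le_iff_le_exp hpos]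
      linarith [Real.add_one_le_exp (1 : ℝ)]
    have h3 : B * lam ^ 2 ≤ B := by nlinarith
    linarith

end Estimation

end GlauberGGM

end

/-! ### Reduction of the theorem to the bound on T λ² -/

theorem theorem2 (βmax : ℝ) (hβmax : βmax < 1) :
    ∃ K : ℝ, 0 < K ∧
      ∀ (p d : ℕ) (lam : ℝ), 2 ≤ p → 1 ≤ d → d ≤ p → 0 < lam → lam ≤ βmax →
      ∀ (δ : ℝ), 0 < δ → δ < 1 / 2 →
      ∀ (n : ℕ) (T : ℝ), T * (p : ℝ) = (n : ℝ) →
      ∀ Ψ : GlauberGGM.Data p n → SimpleGraph (Fin p),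
        (∀ G : SimpleGraph (Fin p), MeasurableSet (Ψ ⁻¹' {G})) →
        GlauberGGM.maxError p d lam n Ψ ≤ 1 / 2 →
        T ≥ Real.log ((p : ℝ) * (d : ℝ) / 4) * δ * ((2 * (1 - δ) - 1) / (2 * (1 - δ))) /
          (K * lam ^ 2 * Real.log (p : ℝ)) := by
  rcases le_or_gt βmax 0 with hβ | hβ
  · exact ⟨1, one_pos, fun p d lam _ _ _ h0 h1 => absurd (h0.trans_le h1) hβ.not_gt⟩
  have hβ2 : 0 < 1 - βmax ^ 2 := by nlinarith
  set B : ℝ := 1 / (1 - βmax ^ 2) with hBdef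
  have hB0 : 0 < B := by positivity
  set c : ℝ := Real.exp (-(2 * B + 2)) / (40 * B) with hcdef
  have hc0 : 0 < c := by positivity
  -- The numerator is at most 2 log p · 1/2 · 1/2 = (log p)/2, so K = 1/(2c) turns T λ² ≥ c into the
  -- claim.
  refine ⟨1 / (2 * c), by positivity, ?_⟩
  intro p d lam hp hd hdp h0 hle δ hδ0 hδ n T hT Ψ hΨ h
  have hp2 : (2 : ℝ) ≤ p := by exact_mod_cast hp
  have hdp' : (d : ℝ) ≤ p := by exact_mod_cast hdp
  have hd1 : (1 : ℝ) ≤ d := by exact_mod_cast hd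
  have hlogp : 0 < Real.log p := Real.log_pos (by linarith)
  have hfrac0 : 0 ≤ (2 * (1 - δ) - 1) / (2 * (1 - δ)) := div_nonneg (by linarith) (by linarith)
  have hfrac1 : (2 * (1 - δ) - 1) / (2 * (1 - δ)) ≤ 1 / 2 := by
    rw [div_le_iff₀ (by linarith)]; linarith
  have hT0 : 0 ≤ T := by
    by_contra hc
    have : (0 : ℝ) ≤ n := Nat.cast_nonneg n
    nlinarith
  rcases le_or_gt (Real.log ((p : ℝ) * d / 4)) 0 with hneg | hpos
  · refine le_trans (div_nonpos_of_nonpos_of_nonneg ?_ (by positivity)) hT0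
    exact mul_nonpos_of_nonpos_of_nonneg (mul_nonpos_of_nonpos_of_nonneg hneg hδ0.le) hfrac0
  have hpd : 1 < (p : ℝ) * d / 4 := by
    by_contra hc
    exact hpos.not_ge (Real.log_nonpos (by positivity) (not_lt.1 hc))
  -- For p = 2, d ≤ p gives pd/4 ≤ 1, the case of a nonpositive right side already settled.
  have hp3 : 3 ≤ p := by
    by_contra hc
    have hp2' : (p : ℝ) ≤ 2 := by exact_mod_cast (by omega : p ≤ 2)
    nlinarith
  have hlam1 : lam < 1 := hle.trans_lt hβmax
  have hB : 1 / (1 - lam ^ 2) ≤ B := by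
    rw [hBdef]
    gcongr
  have hmain := GlauberGGM.le_time_mul_sq hp3 hd h0 hlam1 hB hT hΨ h
  have hlog : Real.log ((p : ℝ) * d / 4) ≤ 2 * Real.log p := by
    rw [← Real.log_rpow (by positivity), Real.rpow_two]
    apply Real.log_le_log (by positivity)
    nlinarith
  rw [ge_iff_le, div_le_iff₀ (by positivity)]
  calc Real.log ((p : ℝ) * d / 4) * δ * ((2 * (1 - δ) - 1) / (2 * (1 - δ)))
      ≤ 2 * Real.log p * (1 / 2) * (1 / 2) := by gcongr
    _ = c * (1 / (2 * c)) * Real.log p := by field_simp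
    _ ≤ T * lam ^ 2 * (1 / (2 * c)) * Real.log p := by gcongr
    _ = T * (1 / (2 * c) * lam ^ 2 * Real.log p) := by ring
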